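/- All graphs are finite and simple. For a graph $H$, a graph $G$ and a map $f$ assigning to each vertex of $G$ a subset of $V(H)$ (its list), $(G,f)$ is \emph{$H$-list-colorable} if there is a map $\varphi:V(G)\to V(H)$ sending adjacent vertices to adjacent vertices with $\varphi(v)\in f(v)$ for all $v$. A graph is \emph{$(P_k,K_{t,t})$-free} if it contains neither the path $P_k$ on $k$ vertices nor the complete bipartite graph $K_{t,t}$ as an induced subgraph. \textbf{Theorem.} Let $H$ be a graph, let $k,t>0$ be integers, let $C$ be the class of all $(P_k,K_{t,t})$-free graphs, and let $Q$ be any family of subsets of $V(H)$. Let $C(Q)$ be the class of all pairs $(G,f)$ with $G\in C$ and $f:V(G)\to Q$. For $(G,f),(G',f')\in C(Q)$ write $(G,f)\le_l(G',f')$ (respectively $(G,f)\subseteq_l(G',f')$) if there is an injective map $\sigma:V(G)\to V(G')$ such that for all $u,v \in V(G)$ one has $uv\in E(G)\iff\sigma(u)\sigma(v)\in E(G')$ (respectively $uv\in E(G)\Rightarrow\sigma(u)\sigma(v)\in E(G')$), and $f(v)\supseteq f'(\sigma(v))$ for all $v\in V(G)$. Then, up to label-preserving isomorphism, only finitely many members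 of $C(Q)$ are $\le_l$-minimal among the members of $C(Q)$ that are not $H$-list-colorable, and only finitely many are $\subseteq_l$-minimal among the members of $C(Q)$ that are not $H$-list-colorable. In particular, for every integer $c>0$ there are, up to isomorphism, only finitely many $(P_k,K_{t,t})$-free graphs that are $c$-critical, i.e. that are not $(c-1)$-colorable while each of their proper subgraphs is. -/

import Mathlib

universe u v w

/-- A finite simple graph. -/
structure FinGraph where
  /-- the vertex set -/
  V : Type u
  /-- the vertex set is finite -/
  finite : Finite V
  /-- the graph on it -/
  graph : SimpleGraph V

namespace FinGraph

/-- Two finite graphs are isomorphic. -/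
def Isomorphic (X Y : FinGraph.{u}) : Prop :=
  Nonempty (X.graph ≃g Y.graph)

/-- `(P_k, K_{t,t})`-free: neither the path on `k` vertices nor the complete bipartite graph with
`t` vertices on each side is an induced subgraph. -/
def IsPathBicliqueFree (k t : ℕ) (X : FinGraph.{u}) : Prop :=
  ¬ (SimpleGraph.pathGraph k).IsIndContained X.graph ∧
    ¬ (completeBipartiteGraph (Fin t) (Fin t)).IsIndContained X.graph

/-- `c`-critical (for `c ≥ 1`): not colorable with `c - 1` colors, although every proper subgraph
is. -/
def IsCritical (c : ℕ) (X : FinGraph.{u}) : Prop :=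
  ¬ X.graph.Colorable (c - 1) ∧ ∀ G' : X.graph.Subgraph, G' ≠ ⊤ → G'.coe.Colorable (c - 1)

end FinGraph

/-- A finite graph whose vertices are labeled by elements of `Q`. -/
structure LabeledGraph (Q : Type v) extends FinGraph.{u} where
  /-- the labeling -/
  label : V → Q

namespace LabeledGraph

/-- Isomorphism of labeled graphs: a graph isomorphism that preserves the labels. -/
def Isomorphic {Q : Type v} (X Y : LabeledGraph.{u} Q) : Prop :=
  ∃ φ : X.graph ≃g Y.graph, ∀ x, Y.label (φ x) = X.label x

/-- The labeled induced-subgraph order. -/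
def InducedLE {Q : Type v} [Preorder Q] (X Y : LabeledGraph.{u} Q) : Prop :=
  ∃ σ : X.graph ↪g Y.graph, ∀ x, X.label x ≤ Y.label (σ x)

/-- The labeled subgraph order (`SimpleGraph.Copy` is an injective graph homomorphism). -/
def SubgraphLE {Q : Type v} [Preorder Q] (X Y : LabeledGraph.{u} Q) : Prop :=
  ∃ σ : SimpleGraph.Copy X.graph Y.graph, ∀ x, X.label x ≤ Y.label (σ x)

end LabeledGraph

/-- The members of a family `Q` of subsets of `W`, ordered by reverse inclusion:
`A ≤ B` iff `B ⊆ A`. -/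
abbrev ReverseLists {W : Type w} (Q : Set (Set W)) : Type w := (↥Q)ᵒᵈ

/-- The subset of `W` that a label stands for. -/
def ReverseLists.list {W : Type w} {Q : Set (Set W)} (A : ReverseLists Q) : Set W :=
  (OrderDual.ofDual A).1

theorem ReverseLists.le_iff {W : Type w} {Q : Set (Set W)} (A B : ReverseLists Q) :
    A ≤ B ↔ B.list ⊆ A.list := Iff.rfl

/-- A graph whose vertices carry lists of vertices of `H` is `H`-list-colorable if it has a
homomorphism to `H` that sends every vertex into its list. -/
def LabeledGraph.IsListColorable {W : Type w} (H : SimpleGraph W) {Q : Set (Set W)}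
    (X : LabeledGraph.{u} (ReverseLists Q)) : Prop :=
  ∃ φ : X.graph →g H, ∀ x, φ x ∈ (X.label x).list

/-- `x` has the property `P`, and nothing strictly smaller than `x` with respect to the
quasi-ordering `r` has it. -/
def IsMinimalFor {α : Type v} (r : α → α → Prop) (P : α → Prop) (x : α) : Prop :=
  P x ∧ ¬ ∃ y, P y ∧ r y x ∧ ¬ r x y

/-- There are only finitely many objects with property `P` up to the equivalence `e`:
finitely many of them represent all of them. -/
def FinitelyManyUpTo {α : Type v} (e : α → α → Prop) (P : α → Prop) : Prop :=
  ∃ T : Set α, T.Finite ∧ (∀ y ∈ T, P y) ∧ ∀ x, P x → ∃ y ∈ T, e x y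

/-!
A `(P_k, K_{t,t})`-free graph with lists that is not `H`-list-colorable contains an uncolorable
induced subgraph whose size is bounded in terms of `H`, `k` and `t` alone
(`exists_small_obstruction`). Hence minimal obstructions and critical graphs have bounded size, and
there are only finitely many of them as there are only finitely many lists. No well-quasi-ordering
is needed.

A clique with more vertices than `H` is an uncolorable subgraph of bounded size. Without such
cliques, a graph that excludes `P_k` and `K_{t,t}` as induced subgraphs has no long paths, induced
or not (`exists_path_length_lt`, a theorem of Galvin, Rival and Sands). In a graph without long
paths, bounded obstructions are found by depth-first search (`exists_finset_of_paths_short`):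
deleting the root `v` of a connected uncolorable graph leaves, for each color `a` of `v`, an
uncolorable component once the choice of `a` is recorded in the lists, and paths that start in this
component at a neighbor of `v` are shorter; the obstructions found in these components, together
with `v`, form an obstruction.

The bound on path lengths is obtained by compactness: an ultraproduct of counterexamples contains a
counterexample on `ℕ` in which successive numbers are adjacent
(`isIndContained_of_traceable_nat`). As geodesics are induced paths, no tail of this graph is
locally finite, so that there are infinitely many vertices `u a` of infinite degree, and there are
disjoint intervals of `ℕ` such that almost all of them contain, for given `a` and `b`, a connector
of bounded size from `u a` to `u b`. Fix a nonprincipal ultrafilter on `ℕ`. The exclusion of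
bicliques (`not_eventually_of_biclique`) says that all adjacencies between these objects other than
the intended ones are exceptional for the ultrafilter; so the objects can be chosen one after the
other in such a way that the unintended adjacencies do not occur (`exists_select₃`). The vertices
and connectors that are chosen form a long sequence of layers, any two of which are anticomplete
unless they are consecutive, and a geodesic through all the layers is a long induced path.
-/

namespace PathBiclique

open SimpleGraph Filter

/-! ### Geodesics as induced paths -/

/-- The first `n` vertices of a geodesic induce a path. -/
theorem pathGraph_isIndContained_of_le_dist {V : Type*} {G : SimpleGraph V} {x y : V} {n : ℕ}
    (hr : G.Reachable x y) (hn : n ≤ G.dist x y + 1) : (pathGraph n).IsIndContained G := by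
  obtain ⟨p, hp⟩ := hr.exists_walk_length_eq_dist
  have hd : ∀ i, i ≤ p.length → G.dist x (p.getVert i) = i := by
    intro i hi
    have h1 : G.dist x (p.getVert i) ≤ i :=
      (dist_le (p.take i)).trans (by rw [Walk.take_length]; exact min_le_left _ _)
    have h2 : G.dist (p.getVert i) y ≤ p.length - i :=
      (dist_le (p.drop i)).trans (by rw [Walk.drop_length])
    have h3 := (p.take i).reachable.dist_triangle_left y
    omega
  have hle : ∀ a : Fin n, (a : ℕ) ≤ p.length := fun a => by have := a.2; omega
  have hinj : Function.Injective fun a : Fin n => p.getVert a := by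
    intro a b hab
    have := congrArg (G.dist x) hab
    simp only [hd _ (hle a), hd _ (hle b)] at this
    exact Fin.ext this
  refine ⟨⟨⟨fun a => p.getVert a, hinj⟩, ?_⟩⟩
  intro a b
  simp only [Function.Embedding.coeFn_mk, pathGraph_adj]
  constructor
  · intro h
    have hne : (a : ℕ) ≠ b := fun e => h.ne (by rw [e])
    have := h.diff_dist_adj (u := x)
    rw [hd _ (hle a), hd _ (hle b)] at this
    omega
  · rintro (h | h)
    · have := p.adj_getVert_succ (i := a) (by have := b.2; omega)
      rwa [h] at this
    · have := p.adj_getVert_succ (i := b) (by have := a.2; omega)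
      rw [h] at this
      exact this.symm

/-- If vertices of `S i` and `S j` are never adjacent for `i + 2 ≤ j`, then a walk inside the union
that ends in `S n` and nowhere earlier passes through all the layers, so the geodesic between its
ends has more than `n` vertices. -/
theorem pathGraph_isIndContained_of_layers {V : Type*} {G : SimpleGraph V} {n : ℕ}
    {T : Set V} (S : ℕ → Set V) (hT : ∀ v ∈ T, ∃ i ≤ n, v ∈ S i)
    (hanti : ∀ i j, i + 2 ≤ j → j ≤ n → ∀ u ∈ S i, ∀ v ∈ S j, ¬ G.Adj u v)
    {x y : T} (hx : x.1 ∈ S 0) (hy : ∀ i < n, y.1 ∉ S i)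
    (hr : (G.induce T).Reachable x y) : (pathGraph n).IsIndContained G := by
  classical
  let φ : T → ℕ := fun v => sInf {i | v.1 ∈ S i}
  have hmem : ∀ v : T, v.1 ∈ S (φ v) := fun v => by
    obtain ⟨i, -, hi⟩ := hT v.1 v.2
    exact Nat.sInf_mem (s := {i | v.1 ∈ S i}) ⟨i, hi⟩
  have hφn : ∀ v : T, φ v ≤ n := fun v => by
    obtain ⟨i, hi, hi'⟩ := hT v.1 v.2
    exact (Nat.sInf_le hi').trans hi
  have hstep : ∀ u v : T, (G.induce T).Adj u v → φ v ≤ φ u + 1 := by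
    intro u v huv
    by_contra hlt
    exact hanti (φ u) (φ v) (by omega) (hφn v) _ (hmem u) _ (hmem v) huv
  have hwalk : ∀ (u v : T) (p : (G.induce T).Walk u v), φ v ≤ φ u + p.length := by
    intro u v p
    induction p with
    | nil => simp
    | cons h p ih =>
      have := hstep _ _ h
      rw [Walk.length_cons]
      omega
  obtain ⟨p, hp⟩ := hr.exists_walk_length_eq_dist
  have h0 : φ x = 0 := Nat.le_zero.1 (Nat.sInf_le hx)
  have hn : n ≤ φ y := by
    by_contra hlt
    exact hy _ (not_le.1 hlt) (hmem y)
  have := hwalk _ _ p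
  exact (pathGraph_isIndContained_of_le_dist hr (by omega)).trans ⟨Embedding.induce T⟩

/-! ### Selection along an ultrafilter -/

/-- If `P a b c i j l` holds for most `i`, most `j` (depending on `i`) and most `l` (depending on
both), then numbers `f 0, f 1, …, f (K - 1)` can be chosen one after the other so that
`P a b c (f a) (f b) (f c)` holds for all `a < b < c < K`. -/
theorem exists_select₃ (U : Ultrafilter ℕ) (K : ℕ) (P : ℕ → ℕ → ℕ → ℕ → ℕ → ℕ → Prop)
    (hP : ∀ a b c, ∀ᶠ i in (U : Filter ℕ), ∀ᶠ j in (U : Filter ℕ), ∀ᶠ l in (U : Filter ℕ),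
      P a b c i j l) :
    ∃ f : ℕ → ℕ, ∀ a b c, a < b → b < c → c < K → P a b c (f a) (f b) (f c) := by
  -- The choices made so far must leave most choices of the remaining indices admissible.
  suffices H : ∀ n, n ≤ K → ∃ f : ℕ → ℕ,
      (∀ a b c, a < b → b < c → c < n → P a b c (f a) (f b) (f c)) ∧
      (∀ a b c, a < b → b < n → c < K → ∀ᶠ l in (U : Filter ℕ), P a b c (f a) (f b) l) ∧
      (∀ a b c, a < n → b < K → c < K →
        ∀ᶠ j in (U : Filter ℕ), ∀ᶠ l in (U : Filter ℕ), P a b c (f a) j l) by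
    obtain ⟨f, hf, -⟩ := H K le_rfl
    exact ⟨f, hf⟩
  intro n
  induction n with
  | zero => exact fun _ => ⟨id, by simp, by simp, by simp⟩
  | succ n ih =>
    intro hn
    obtain ⟨f, h3, h2, h1⟩ := ih (by omega)
    have e1 : ∀ᶠ z in (U : Filter ℕ), ∀ a < n, ∀ b < n, a < b → P a b n (f a) (f b) z := by
      refine (Set.finite_lt_nat n).eventually_all.2 fun a _ =>
        (Set.finite_lt_nat n).eventually_all.2 fun b hb => ?_
      by_cases hab : a < b
      · exact (h2 a b n hab hb (by omega)).mono fun z hz _ => hz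
      · exact Eventually.of_forall fun z h => absurd h hab
    have e2 : ∀ᶠ z in (U : Filter ℕ), ∀ a < n, ∀ c < K,
        ∀ᶠ l in (U : Filter ℕ), P a n c (f a) z l :=
      (Set.finite_lt_nat n).eventually_all.2 fun a ha =>
        (Set.finite_lt_nat K).eventually_all.2 fun c hc => h1 a n c ha (by omega) hc
    have e3 : ∀ᶠ z in (U : Filter ℕ), ∀ b < K, ∀ c < K,
        ∀ᶠ j in (U : Filter ℕ), ∀ᶠ l in (U : Filter ℕ), P n b c z j l :=
      (Set.finite_lt_nat K).eventually_all.2 fun b _ =>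
        (Set.finite_lt_nat K).eventually_all.2 fun c _ => hP n b c
    obtain ⟨z, z1, z2, z3⟩ := (e1.and (e2.and e3)).exists
    have hu : ∀ a, a < n → Function.update f n z a = f a := fun a ha =>
      Function.update_of_ne (by omega) _ _
    have hz : Function.update f n z n = z := Function.update_self _ _ _
    refine ⟨Function.update f n z, ?_, ?_, ?_⟩
    · intro a b c hab hbc hc
      rw [hu a (by omega), hu b (by omega)]
      rcases Nat.lt_succ_iff_lt_or_eq.1 hc with hc | rfl
      · rw [hu c hc]; exact h3 a b c hab hbc hc
      · rw [hz]; exact z1 a (by omega) b hbc hab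
    · intro a b c hab hb hc
      rw [hu a (by omega)]
      rcases Nat.lt_succ_iff_lt_or_eq.1 hb with hb | rfl
      · rw [hu b hb]; exact h2 a b c hab hb hc
      · rw [hz]; exact z2 a hab c hc
    · intro a b c ha hb hc
      rcases Nat.lt_succ_iff_lt_or_eq.1 ha with ha | rfl
      · rw [hu a ha]; exact h1 a b c ha hb hc
      · rw [hz]; exact z3 b hb c hc

/-- The version of `exists_select₃` for pairs. -/
theorem exists_select₂ (U : Ultrafilter ℕ) (K : ℕ) (P : ℕ → ℕ → ℕ → ℕ → Prop)
    (hP : ∀ a b, ∀ᶠ i in (U : Filter ℕ), ∀ᶠ j in (U : Filter ℕ), P a b i j) :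
    ∃ f : ℕ → ℕ, ∀ a b, a < b → b < K → P a b (f a) (f b) := by
  obtain ⟨f, hf⟩ := exists_select₃ U (K + 1) (fun a b _ i j _ => P a b i j)
    fun a b _ => (hP a b).mono fun i hi => hi.mono fun j hj => Eventually.of_forall fun _ => hj
  exact ⟨f, fun a b hab hb => hf a b (b + 1) hab (by omega) (by omega)⟩

theorem eventually_hyperfilter_ge (a : ℕ) : ∀ᶠ i in (hyperfilter ℕ : Filter ℕ), a ≤ i :=
  Nat.hyperfilter_le_atTop (eventually_ge_atTop a)

section

variable {G : SimpleGraph ℕ} {k s t : ℕ}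

/-- In a graph with bounded cliques, no sequence of vertices is adjacent at most pairs. -/
theorem eventually_eventually_not_adj
    (hK : ¬ (⊤ : SimpleGraph (Fin s)).IsIndContained G) (x : ℕ → ℕ) :
    ∀ᶠ i in (hyperfilter ℕ : Filter ℕ), ∀ᶠ j in (hyperfilter ℕ : Filter ℕ),
      ¬ G.Adj (x i) (x j) := by
  by_contra h
  simp only [Ultrafilter.eventually_not, not_not] at h
  obtain ⟨f, hf⟩ := exists_select₂ (hyperfilter ℕ) s (fun _ _ i j => G.Adj (x i) (x j))
    fun _ _ => h
  have key : ∀ a b : Fin s, a ≠ b → G.Adj (x (f a)) (x (f b)) := by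
    intro a b hab
    rcases lt_or_gt_of_ne hab with h | h
    · exact hf a b h b.2
    · exact (hf b a h a.2).symm
  refine hK ⟨⟨⟨fun a => x (f a), fun a b hab => ?_⟩, fun {a b} => ?_⟩⟩
  · by_contra hne
    exact (key a b hne).ne hab
  · simp only [top_adj]
    exact ⟨fun h e => h.ne (by rw [e]), key a b⟩

/-- A large set of indices contains `t` of them at which an injective sequence takes distinct,
pairwise nonadjacent values. -/
theorem exists_independent (hK : ¬ (⊤ : SimpleGraph (Fin s)).IsIndContained G) (t : ℕ)
    {x : ℕ → ℕ} (hx : Function.Injective x) {A : ℕ → Prop}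
    (hA : ∀ᶠ i in (hyperfilter ℕ : Filter ℕ), A i) :
    ∃ f : Fin t → ℕ, (∀ a, A (f a)) ∧ (Function.Injective fun a => x (f a)) ∧
      ∀ a b, ¬ G.Adj (x (f a)) (x (f b)) := by
  obtain ⟨f, hf⟩ := exists_select₂ (hyperfilter ℕ) (t + 1)
    (fun _ _ i j => A i ∧ i < j ∧ ¬ G.Adj (x i) (x j))
    fun _ _ => by
      filter_upwards [hA, eventually_eventually_not_adj hK x] with i hi hi'
      filter_upwards [hi', eventually_hyperfilter_ge (i + 1)] with j hj hj'
      exact ⟨hi, hj', hj⟩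
  refine ⟨fun a => f a, fun a => (hf a t a.2 (by omega)).1, ?_, ?_⟩
  · intro a b hab
    have hab := hx hab
    rcases lt_trichotomy a b with h | h | h
    · exact absurd hab (hf a b h (by omega)).2.1.ne
    · exact h
    · exact absurd hab (hf b a h (by omega)).2.1.ne'
  · intro a b hab
    rcases lt_trichotomy a b with h | h | h
    · exact (hf a b h (by omega)).2.2 hab
    · subst h; exact hab.ne rfl
    · exact (hf b a h (by omega)).2.2 hab.symm

/-- In a graph without large cliques and large induced bicliques, it is impossible that, for a large
set of terms of an injective sequence `x`, any finitely many of them are adjacent to most terms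
of some other injective sequence. -/
theorem not_eventually_of_biclique (hK : ¬ (⊤ : SimpleGraph (Fin s)).IsIndContained G)
    (hB : ¬ (completeBipartiteGraph (Fin t) (Fin t)).IsIndContained G)
    {x : ℕ → ℕ} (hx : Function.Injective x) {A : ℕ → Prop}
    (hA : ∀ F : Finset ℕ, (∀ c ∈ F, A c) → ∃ y : ℕ → ℕ, Function.Injective y ∧
      ∀ c ∈ F, ∀ᶠ i in (hyperfilter ℕ : Filter ℕ), G.Adj (x c) (y i)) :
    ∀ᶠ c in (hyperfilter ℕ : Filter ℕ), ¬ A c := by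
  rw [Ultrafilter.eventually_not]
  intro hA'
  obtain ⟨f, hfA, hfi, hf⟩ := exists_independent hK t hx hA'
  obtain ⟨y, hy, hxy⟩ := hA (Finset.univ.image f) (by simpa using hfA)
  have hxy' : ∀ᶠ i in (hyperfilter ℕ : Filter ℕ), ∀ a, G.Adj (x (f a)) (y i) :=
    eventually_all.2 fun a => hxy _ (Finset.mem_image_of_mem _ (Finset.mem_univ a))
  obtain ⟨g, hgA, hgi, hg⟩ := exists_independent hK t hy hxy'
  refine hB ⟨⟨⟨Sum.elim (fun a => x (f a)) (fun a => y (g a)), ?_⟩, ?_⟩⟩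
  · exact hfi.sumElim hgi fun a b => (hgA b a).ne
  · rintro (a | a) (b | b)
    · simpa using hf a b
    · simpa using hgA b a
    · simpa using (hgA a b).symm
    · simpa using hg a b

end

/-! ### Infinite traceable graphs -/

theorem reachable_induce_of_interval {G : SimpleGraph ℕ} (hG : ∀ i, G.Adj i (i + 1)) {T : Set ℕ}
    {lo hi : ℕ} (hle : lo ≤ hi) (hT : ∀ v, lo ≤ v → v ≤ hi → v ∈ T) :
    (G.induce T).Reachable ⟨lo, hT lo le_rfl hle⟩ ⟨hi, hT hi hle le_rfl⟩ := by
  induction hi, hle using Nat.le_induction with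
  | base => exact Reachable.refl _
  | succ m hm ih =>
    refine (ih fun v h1 h2 => hT v h1 (by omega)).trans (Adj.reachable ?_)
    exact hG m

theorem finite_setOf_dist_le {V : Type*} {G : SimpleGraph V} (hG : ∀ v, (G.neighborSet v).Finite)
    {x : V} (hx : ∀ v, G.Reachable x v) (r : ℕ) : {v | G.dist x v ≤ r}.Finite := by
  induction r with
  | zero =>
    refine (Set.finite_singleton x).subset fun v hv => ?_
    exact ((hx v).dist_eq_zero_iff.1 (Nat.le_zero.1 hv)).symm
  | succ r ih =>
    refine ((Set.finite_singleton x).union (ih.biUnion fun w _ => hG w)).subset fun v hv => ?_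
    obtain ⟨p, hp⟩ := (hx v).exists_walk_length_eq_dist
    rcases Nat.eq_zero_or_pos p.length with h0 | h0
    · exact Or.inl (Walk.eq_of_length_eq_zero h0).symm
    · right
      have hadj := p.adj_getVert_succ (i := p.length - 1) (by omega)
      rw [Nat.sub_add_cancel h0, p.getVert_length] at hadj
      refine Set.mem_biUnion (x := p.getVert (p.length - 1)) ?_ hadj
      have : G.dist x (p.getVert (p.length - 1)) ≤ p.length - 1 :=
        (dist_le (p.take _)).trans (by rw [Walk.take_length]; exact min_le_left _ _)
      have hv : G.dist x v ≤ r + 1 := hv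
      exact this.trans (by omega)

section

variable {G : SimpleGraph ℕ} {k s t : ℕ}

/-- Otherwise a tail of the graph is connected, infinite and locally finite, so it has arbitrarily
long geodesics. -/
theorem exists_infinite_neighborSet (hG : ∀ i, G.Adj i (i + 1))
    (hP : ¬ (pathGraph k).IsIndContained G) (a : ℕ) : ∃ u ≥ a, (G.neighborSet u).Infinite := by
  by_contra! h
  let T : Set ℕ := Set.Ici a
  have hfin : ∀ v : T, ((G.induce T).neighborSet v).Finite := fun v => by
    refine Set.Finite.of_finite_image (f := Subtype.val) ?_ Subtype.val_injective.injOn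
    exact (h v.1 v.2).subset (by rintro _ ⟨w, hw, rfl⟩; exact hw)
  let x : T := ⟨a, le_refl a⟩
  have hx : ∀ v : T, (G.induce T).Reachable x v := fun v =>
    reachable_induce_of_interval hG v.2 fun w hw _ => hw
  have : Infinite T := (Set.Ici_infinite a).to_subtype
  obtain ⟨v, hv⟩ := (finite_setOf_dist_le hfin hx k).exists_notMem
  have hv : k < (G.induce T).dist x v := not_le.1 hv
  exact hP ((pathGraph_isIndContained_of_le_dist (hx v) (by omega)).trans ⟨Embedding.induce T⟩)

/-- Pairwise disjoint intervals `[g i, g (i + 1))` such that the `i`-th of them meets the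
neighborhoods of `u 0, …, u i`. -/
theorem exists_windows {u : ℕ → ℕ} (hu : ∀ a, (G.neighborSet (u a)).Infinite) :
    ∃ g : ℕ → ℕ, StrictMono g ∧
      ∀ i, ∀ a ≤ i, ∃ v, g i ≤ v ∧ v < g (i + 1) ∧ G.Adj (u a) v := by
  have hstep : ∀ lo i : ℕ, ∃ hi, lo < hi ∧ ∀ a ≤ i, ∃ v, lo ≤ v ∧ v < hi ∧ G.Adj (u a) v := by
    intro lo i
    choose w hw hlo using fun a => (hu a).exists_gt lo
    refine ⟨lo + 1 + ∑ a ∈ Finset.range (i + 1), (w a + 1), by omega, fun a ha =>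
      ⟨w a, (hlo a).le, ?_, hw a⟩⟩
    have := Finset.single_le_sum (f := fun a => w a + 1) (fun _ _ => Nat.zero_le _)
      (Finset.mem_range.2 (by omega : a < i + 1))
    change w a + 1 ≤ _ at this
    omega
  choose hi hlt hhi using hstep
  refine ⟨fun i => Nat.rec 0 (fun i lo => hi lo i) i, strictMono_nat_of_lt_succ fun i => ?_,
    fun i => hhi _ i⟩
  exact hlt _ i

/-- Inside the windows, any two of the vertices `u a`, `u b` are joined through `k + 1` vertices
(repetitions allowed), as the geodesics of a window are short. -/
theorem exists_connectors (hG : ∀ i, G.Adj i (i + 1))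
    (hP : ¬ (pathGraph k).IsIndContained G) {u g : ℕ → ℕ} (hg : StrictMono g)
    (hug : ∀ i, ∀ a ≤ i, ∃ v, g i ≤ v ∧ v < g (i + 1) ∧ G.Adj (u a) v) (a b i : ℕ) :
    ∃ x : ℕ → ℕ, (∀ α, g i ≤ x α ∧ x α < g (i + 1)) ∧
      (a ≤ i → b ≤ i → G.Adj (u a) (x 0) ∧ G.Adj (x k) (u b) ∧
        ∀ α < k, x α = x (α + 1) ∨ G.Adj (x α) (x (α + 1))) := by
  by_cases hab : a ≤ i ∧ b ≤ i
  · obtain ⟨v, hv1, hv2, hv⟩ := hug i a hab.1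
    obtain ⟨w, hw1, hw2, hw⟩ := hug i b hab.2
    have hr : ∀ z : Set.Ico (g i) (g (i + 1)), (G.induce (Set.Ico (g i) (g (i + 1)))).Reachable
        ⟨g i, Set.left_mem_Ico.2 (hg i.lt_succ_self)⟩ z := fun z =>
      reachable_induce_of_interval hG z.2.1 fun y h1 h2 => Set.mem_Ico.2 ⟨h1, h2.trans_lt z.2.2⟩
    have hvw := (hr ⟨v, Set.mem_Ico.2 ⟨hv1, hv2⟩⟩).symm.trans (hr ⟨w, Set.mem_Ico.2 ⟨hw1, hw2⟩⟩)
    obtain ⟨p, hp⟩ := hvw.exists_walk_length_eq_dist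
    have hlen : p.length ≤ k := by
      by_contra hlt
      exact hP ((pathGraph_isIndContained_of_le_dist hvw (by omega)).trans
        ⟨Embedding.induce _⟩)
    refine ⟨fun α => (p.getVert α).1, fun α => (p.getVert α).2, fun _ _ => ⟨?_, ?_, ?_⟩⟩
    · simpa using hv
    · simpa [p.getVert_of_length_le hlen] using hw.symm
    · intro α _
      rcases lt_or_ge α p.length with h | h
      · exact Or.inr (p.adj_getVert_succ h)
      · left
        simp only [p.getVert_of_length_le h, p.getVert_of_length_le (h.trans α.le_succ)]
  · exact ⟨fun _ => g i, fun _ => ⟨le_rfl, hg i.lt_succ_self⟩, fun h1 h2 => absurd ⟨h1, h2⟩ hab⟩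

/-- The infinite form of the Galvin–Rival–Sands theorem: a graph on `ℕ` in which successive numbers
are adjacent contains a long induced path, a large induced biclique or a large clique. -/
theorem isIndContained_of_traceable_nat (hG : ∀ i, G.Adj i (i + 1))
    (hK : ¬ (⊤ : SimpleGraph (Fin s)).IsIndContained G)
    (hB : ¬ (completeBipartiteGraph (Fin t) (Fin t)).IsIndContained G) :
    (pathGraph k).IsIndContained G := by
  by_contra hP
  -- Vertices `u a` of infinite degree, windows, and connectors `X a b i` of bounded size.
  choose nx hnx hnx' using fun a => exists_infinite_neighborSet hG hP a
  obtain ⟨u, hu, huinf⟩ : ∃ u : ℕ → ℕ, StrictMono u ∧ ∀ a, (G.neighborSet (u a)).Infinite := by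
    refine ⟨fun a => Nat.rec (nx 0) (fun _ v => nx (v + 1)) a,
      strictMono_nat_of_lt_succ fun a => hnx _, fun a => ?_⟩
    cases a <;> exact hnx' _
  obtain ⟨g, hg, hug⟩ := exists_windows huinf
  choose X hXg hX using exists_connectors hG hP hg hug
  have hXge : ∀ a b i α, i ≤ X a b i α := fun a b i α => hg.le_apply.trans (hXg a b i α).1
  have hXinj : ∀ a b α, Function.Injective fun i => X a b i α := fun a b α =>
    StrictMono.injective (strictMono_nat_of_lt_succ fun i =>
      (hXg a b i α).2.trans_le (hXg a b (i + 1) α).1)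
  -- For given `a` and `b`, few of the `u c` see most of the connectors from `u a` to `u b`.
  have hlate : ∀ a b, ∀ᶠ c in (hyperfilter ℕ : Filter ℕ), ∀ α ≤ k,
      ∀ᶠ i in (hyperfilter ℕ : Filter ℕ), ¬ G.Adj (u c) (X a b i α) := by
    refine fun a b => (Set.finite_le_nat k).eventually_all.2 fun α _ => ?_
    exact (not_eventually_of_biclique hK hB hu.injective fun F hF =>
      ⟨fun i => X a b i α, hXinj a b α, hF⟩).mono fun c hc => Ultrafilter.eventually_not.2 hc
  -- For most `c`, few of the pairs `a`, `b` chosen after `c` have connectors that `u c` sees.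
  have hearly : ∀ᶠ c in (hyperfilter ℕ : Filter ℕ), ∀ᶠ a in (hyperfilter ℕ : Filter ℕ),
      ∀ᶠ b in (hyperfilter ℕ : Filter ℕ), ∀ α ≤ k,
      ∀ᶠ i in (hyperfilter ℕ : Filter ℕ), ¬ G.Adj (u c) (X a b i α) := by
    suffices h : ∀ α ≤ k, ∀ᶠ c in (hyperfilter ℕ : Filter ℕ), ∀ᶠ a in (hyperfilter ℕ : Filter ℕ),
        ∀ᶠ b in (hyperfilter ℕ : Filter ℕ), ∀ᶠ i in (hyperfilter ℕ : Filter ℕ),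
        ¬ G.Adj (u c) (X a b i α) by
      filter_upwards [(Set.finite_le_nat k).eventually_all.2 h] with c hc
      filter_upwards [(Set.finite_le_nat k).eventually_all.2 hc] with a ha
      exact (Set.finite_le_nat k).eventually_all.2 ha
    intro α _
    simp only [Ultrafilter.eventually_not]
    rw [← Ultrafilter.eventually_not]
    refine not_eventually_of_biclique hK hB hu.injective fun F hF => ?_
    obtain ⟨a, ha⟩ := ((Filter.eventually_all_finset F).2 hF).exists
    obtain ⟨b, hb⟩ := ((Filter.eventually_all_finset F).2 ha).exists
    exact ⟨fun i => X a b i α, hXinj a b α, hb⟩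
  have hXX : ∀ a b a' b', ∀ᶠ i in (hyperfilter ℕ : Filter ℕ),
      ∀ᶠ i' in (hyperfilter ℕ : Filter ℕ), ∀ α ≤ k, ∀ β ≤ k,
        ¬ G.Adj (X a b i α) (X a' b' i' β) := by
    intro a b a' b'
    suffices h : ∀ α ≤ k, ∀ β ≤ k, ∀ᶠ i in (hyperfilter ℕ : Filter ℕ),
        ∀ᶠ i' in (hyperfilter ℕ : Filter ℕ), ¬ G.Adj (X a b i α) (X a' b' i' β) by
      filter_upwards [(Set.finite_le_nat k).eventually_all.2 fun α hα =>
        (Set.finite_le_nat k).eventually_all.2 (h α hα)] with i hi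
      exact (Set.finite_le_nat k).eventually_all.2 fun α hα =>
        (Set.finite_le_nat k).eventually_all.2 (hi α hα)
    intro α _ β _
    exact (not_eventually_of_biclique hK hB (hXinj a b α) fun F hF =>
      ⟨fun i => X a' b' i β, hXinj a' b' β, hF⟩).mono fun i hi => Ultrafilter.eventually_not.2 hi
  obtain ⟨f, hf⟩ := exists_select₃ (hyperfilter ℕ) (k + 3)
    (fun _ _ _ a b c => (a < b ∧ ¬ G.Adj (u a) (u b)) ∧
      (∀ α ≤ k, ∀ᶠ i in (hyperfilter ℕ : Filter ℕ), ¬ G.Adj (u c) (X a b i α)) ∧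
      (∀ α ≤ k, ∀ᶠ i in (hyperfilter ℕ : Filter ℕ), ¬ G.Adj (u a) (X b c i α)))
    fun _ _ _ => by
      filter_upwards [eventually_eventually_not_adj hK u, hearly] with a h1 h2
      filter_upwards [h1, h2, eventually_hyperfilter_ge (a + 1)] with b h3 h4 h5
      filter_upwards [hlate a b, h4] with c h6 h7
      exact ⟨⟨h5, h3⟩, h6, h7⟩
  have hflt : ∀ a b, a < b → b ≤ k + 1 → f a < f b := fun a b hab hb =>
    (hf a b (b + 1) hab (by omega) (by omega)).1.1
  let Y : ℕ → ℕ → ℕ → ℕ := fun j i α => X (f j) (f (j + 1)) i α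
  -- Conditions on the `j`-th window that do not involve the other windows.
  have hone : ∀ j ≤ k, ∀ᶠ i in (hyperfilter ℕ : Filter ℕ), f j ≤ i ∧ f (j + 1) ≤ i ∧
      u (f k) < i ∧ ∀ c ≤ k, c < j ∨ j + 1 < c → ∀ α ≤ k, ¬ G.Adj (u (f c)) (Y j i α) := by
    intro j hj
    refine (eventually_hyperfilter_ge _).and <| (eventually_hyperfilter_ge _).and <|
      (eventually_hyperfilter_ge _).and <| (Set.finite_le_nat k).eventually_all.2 fun c hc => ?_
    have hc : c ≤ k := hc
    by_cases h : c < j ∨ j + 1 < c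
    · refine Eventually.mono ((Set.finite_le_nat k).eventually_all.2 fun α hα => ?_)
        fun i hi _ => hi
      rcases h with h | h
      · exact (hf c j (j + 1) h (by omega) (by omega)).2.2 α hα
      · exact (hf j (j + 1) c (by omega) h (by omega)).2.1 α hα
    · exact Eventually.of_forall fun i h' => absurd h' h
  obtain ⟨w, hw⟩ := exists_select₂ (hyperfilter ℕ) (k + 2)
    (fun j j' i i' => j < j' → j' ≤ k + 1 → (f j ≤ i ∧ f (j + 1) ≤ i ∧
      u (f k) < i ∧ ∀ c ≤ k, c < j ∨ j + 1 < c → ∀ α ≤ k, ¬ G.Adj (u (f c)) (Y j i α)) ∧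
      ∀ α ≤ k, ∀ β ≤ k, ¬ G.Adj (Y j i α) (Y j' i' β))
    fun j j' => by
      by_cases hj : j < j' ∧ j' ≤ k + 1
      · filter_upwards [hone j (by omega), hXX (f j) (f (j + 1)) (f j') (f (j' + 1))] with i h1 h2
        filter_upwards [h2] with i' h3 _ _
        exact ⟨h1, h3⟩
      · exact Eventually.of_forall fun i => Eventually.of_forall fun i' h1 h2 => absurd ⟨h1, h2⟩ hj
  have hw1 := fun j (hj : j ≤ k) =>
    (hw j (j + 1) j.lt_succ_self (by omega) j.lt_succ_self (by omega)).1
  have hw2 := fun j j' (h : j < j') (hj : j' ≤ k) => (hw j j' h (by omega) h (by omega)).2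
  -- The `j`-th layer consists of `u (f j)` and the connector from there to `u (f (j + 1))`.
  let S : ℕ → Set ℕ := fun j => {v | v = u (f j) ∨ ∃ α ≤ k, v = Y j (w j) α}
  let T : Set ℕ := {v | ∃ j ≤ k, v ∈ S j}
  have hYT : ∀ j ≤ k, ∀ α ≤ k, Y j (w j) α ∈ T := fun j hj α hα => ⟨j, hj, Or.inr ⟨α, hα, rfl⟩⟩
  have huT : ∀ j ≤ k, u (f j) ∈ T := fun j hj => ⟨j, hj, Or.inl rfl⟩
  have hreach : ∀ j (hj : j ≤ k), (G.induce T).Reachable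
      ⟨u (f 0), huT 0 (Nat.zero_le k)⟩ ⟨u (f j), huT j hj⟩ := by
    intro j
    induction j with
    | zero => exact fun _ => Reachable.refl _
    | succ j ih =>
      intro hj
      have hj' : j ≤ k := by omega
      obtain ⟨h1, h2, -⟩ := hw1 j hj'
      obtain ⟨e1, e2, e3⟩ := hX (f j) (f (j + 1)) (w j) h1 h2
      have hY : ∀ α (hα : α ≤ k), (G.induce T).Reachable
          ⟨u (f j), huT j hj'⟩ ⟨Y j (w j) α, hYT j hj' α hα⟩ := by
        intro α
        induction α with
        | zero => exact fun _ => Adj.reachable e1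
        | succ α ihα =>
          intro hα
          refine (ihα (by omega)).trans ?_
          rcases e3 α (by omega) with h | h
          · have : (⟨Y j (w j) α, hYT j hj' α (by omega)⟩ : T) =
                ⟨Y j (w j) (α + 1), hYT j hj' (α + 1) hα⟩ := Subtype.ext h
            rw [this]
          · exact Adj.reachable h
      exact (ih hj').trans ((hY k le_rfl).trans (Adj.reachable e2))
  refine hP (pathGraph_isIndContained_of_layers (n := k) (T := T) S (fun v hv => hv) ?_
    (Or.inl rfl) ?_ (hreach k le_rfl))
  · rintro i j hij hj v (rfl | ⟨α, hα, rfl⟩) z (rfl | ⟨β, hβ, rfl⟩)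
    · exact (hf i j (j + 1) (by omega) (by omega) (by omega)).1.2
    · exact (hw1 j hj).2.2.2 i (by omega) (Or.inl (by omega)) β hβ
    · exact fun h => (hw1 i (by omega)).2.2.2 j hj (Or.inr (by omega)) α hα h.symm
    · exact hw2 i j (by omega) hj α hα β hβ
  · rintro i hi (h | ⟨α, hα, h⟩)
    · exact (hflt i k hi (by omega)).ne (hu.injective h).symm
    · have h1 := (hw1 i hi.le).2.2.1
      have h2 := hXge (f i) (f (i + 1)) (w i) α
      have h : u (f k) = X (f i) (f (i + 1)) (w i) α := h
      omega

end

/-! ### Compactness: bounding the length of paths -/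

/-- The finite Galvin–Rival–Sands theorem, for lists of vertices that form a path: graphs of
unbounded path length would have an ultraproduct that contradicts the infinite form, as induced
copies of a finite graph in the ultraproduct come from induced copies in one of the factors. -/
theorem exists_path_length_lt (k t s : ℕ) : ∃ n : ℕ, ∀ (V : Type u) (G : SimpleGraph V),
    ¬ (pathGraph k).IsIndContained G →
    ¬ (completeBipartiteGraph (Fin t) (Fin t)).IsIndContained G →
    ¬ (⊤ : SimpleGraph (Fin s)).IsIndContained G →
    ∀ l : List V, l.Nodup → l.IsChain G.Adj → l.length < n := by
  by_contra! h
  choose V G hP hB hK l hnd hch hlen using h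
  let A : SimpleGraph ℕ :=
    { Adj := fun i j => ∀ᶠ n in (hyperfilter ℕ : Filter ℕ),
        ∃ (hi : i < (l n).length) (hj : j < (l n).length), (G n).Adj (l n)[i] (l n)[j]
      symm := ⟨fun i j h => h.mono fun n ⟨hi, hj, h⟩ => ⟨hj, hi, h.symm⟩⟩
      loopless := ⟨fun i h => by
        obtain ⟨n, _, _, h⟩ := h.exists
        exact h.ne rfl⟩ }
  have hA : ∀ i, A.Adj i (i + 1) := fun i => by
    filter_upwards [eventually_hyperfilter_ge (i + 2)] with n hn
    have hi : i + 1 < (l n).length := by have := hlen n; omega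
    exact ⟨by omega, hi, List.isChain_iff_getElem.1 (hch n) i hi⟩
  have htrans : ∀ {α : Type} [Finite α] (F : SimpleGraph α), F.IsIndContained A →
      ∃ n, F.IsIndContained (G n) := by
    rintro α _ F ⟨e⟩
    have e1 : ∀ᶠ n in (hyperfilter ℕ : Filter ℕ), ∀ a, e a < (l n).length :=
      eventually_all.2 fun a => (eventually_hyperfilter_ge (e a + 1)).mono fun n hn => by
        have := hlen n
        omega
    have e2 : ∀ᶠ n in (hyperfilter ℕ : Filter ℕ), ∀ a b, (F.Adj a b ↔
        ∃ (hi : e a < (l n).length) (hj : e b < (l n).length),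
          (G n).Adj (l n)[e a] (l n)[e b]) := by
      refine eventually_all.2 fun a => eventually_all.2 fun b => ?_
      by_cases hab : F.Adj a b
      · have : A.Adj (e a) (e b) := e.map_adj_iff.2 hab
        exact this.mono fun n hn => iff_of_true hab hn
      · have : ¬ A.Adj (e a) (e b) := fun h => hab (e.map_adj_iff.1 h)
        exact (Ultrafilter.eventually_not.2 this).mono fun n hn => iff_of_false hab hn
    obtain ⟨n, h1, h2⟩ := (e1.and e2).exists
    refine ⟨n, ⟨⟨⟨fun a => (l n)[e a]'(h1 a), fun a b hab => ?_⟩, fun {a b} => ?_⟩⟩⟩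
    · exact e.injective ((hnd n).getElem_inj_iff.1 hab)
    · exact ⟨fun h => (h2 a b).2 ⟨h1 a, h1 b, h⟩, fun h => ((h2 a b).1 h).2.2⟩
  obtain ⟨n, hn⟩ := htrans _ (isIndContained_of_traceable_nat (k := k) (s := s) (t := t) hA
    (fun h => (htrans _ h).elim hK) (fun h => (htrans _ h).elim hB))
  exact hP n hn

/-! ### List colorings of graphs with short paths -/

section Coloring

variable {V : Type u} {W : Type w} (G : SimpleGraph V) (H : SimpleGraph W)

/-- The subgraph of `G` induced by `S` has a homomorphism to `H` that respects the lists `L`.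
The map is defined on all vertices; its values outside of `S` are irrelevant. -/
def ListColorableOn (L : V → Set W) (S : Set V) : Prop :=
  ∃ φ : V → W, (∀ v ∈ S, φ v ∈ L v) ∧ ∀ u ∈ S, ∀ v ∈ S, G.Adj u v → H.Adj (φ u) (φ v)

/-- Two vertices are joined by a walk of `G` inside `S` (or are equal). -/
def ReachIn (S : Set V) : V → V → Prop :=
  Relation.ReflTransGen fun a b => a ∈ S ∧ b ∈ S ∧ G.Adj a b

variable {G H}

theorem ReachIn.symm {S : Set V} {x y : V} (h : ReachIn G S x y) : ReachIn G S y x := by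
  induction h with
  | refl => exact .refl
  | tail _ hbc ih => exact .head ⟨hbc.2.1, hbc.1, hbc.2.2.symm⟩ ih

theorem ReachIn.mem {S : Set V} {x y : V} (h : ReachIn G S x y) (hx : x ∈ S) : y ∈ S := by
  cases h with
  | refl => exact hx
  | tail _ h => exact h.2.1

theorem ReachIn.in_component {S : Set V} {x y : V} (h : ReachIn G S x y) :
    ReachIn G {z | ReachIn G S x z} x y := by
  induction h with
  | refl => exact .refl
  | tail hab hbc ih => exact .tail ih ⟨hab, .tail hab hbc, hbc.2.2⟩

/-- Colorings of the components combine to a coloring. -/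
theorem exists_component_not_listColorableOn [Nonempty W] {L : V → Set W} {S : Set V}
    (h : ¬ ListColorableOn G H L S) :
    ∃ x ∈ S, ¬ ListColorableOn G H L {y | ReachIn G S x y} := by
  by_contra! hc
  choose! ψ hψL hψ using hc
  let r : Setoid V := ⟨ReachIn G S, fun _ => .refl, ReachIn.symm, Relation.ReflTransGen.trans⟩
  let rep : V → V := fun y => (Quotient.mk r y).out
  have hrep : ∀ y, ReachIn G S (rep y) y := fun y => Quotient.mk_out (s := r) y
  have hmem : ∀ y ∈ S, rep y ∈ S := fun y hy => (hrep y).symm.mem hy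
  refine h ⟨fun y => ψ (rep y) y, fun y hy => hψL _ (hmem y hy) _ (hrep y), fun y hy z hz hyz => ?_⟩
  have hyz' : ReachIn G S y z := .single ⟨hy, hz, hyz⟩
  have e : rep y = rep z := congrArg Quotient.out (Quotient.sound (s := r) hyz')
  have := hψ (rep y) (hmem y hy) y (hrep y) z (by rw [e]; exact hrep z) hyz
  change H.Adj (ψ (rep y) y) (ψ (rep z) z)
  rwa [← e]

/-- In a connected set, every vertex other than `v` is reached from a neighbor of `v` without
passing through `v`. -/
theorem ReachIn.exists_adj {S : Set V} {v y : V} (h : ReachIn G S v y) (hy : y ≠ v) :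
    ∃ x ∈ S \ {v}, G.Adj v x ∧ ReachIn G (S \ {v}) x y := by
  induction h with
  | refl => exact absurd rfl hy
  | @tail b c hab hbc ih =>
    by_cases hb : b = v
    · subst hb
      exact ⟨c, ⟨hbc.2.1, hy⟩, hbc.2.2, .refl⟩
    · obtain ⟨x, hx, hvx, hxb⟩ := ih hb
      exact ⟨x, hx, hvx, .tail hxb ⟨⟨hbc.1, hb⟩, ⟨hbc.2.1, hy⟩, hbc.2.2⟩⟩

/-- The bound of `exists_finset_of_paths_short`. -/
def obstructionBound (h : ℕ) : ℕ → ℕ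
  | 0 => 0
  | n + 1 => 1 + h * obstructionBound h n

/-- A connected set in which all paths from a given vertex `v` are short has a small uncolorable
subset if it is uncolorable. For each color `a` of `v` the remaining vertices cannot be colored from
the lists reduced by the choice of `a`; an uncolorable component of them contains a neighbor of `v`,
paths from which are shorter. -/
theorem exists_finset_of_paths_short [Fintype W] [Nonempty W] (n : ℕ) :
    ∀ (L : V → Set W) (S : Set V), ∀ v ∈ S, (∀ x ∈ S, ReachIn G S v x) →
      (∀ l : List V, (v :: l).Nodup → (v :: l).IsChain G.Adj → (∀ x ∈ v :: l, x ∈ S) →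
        l.length < n) →
      ¬ ListColorableOn G H L S →
      ∃ T : Finset V, (T : Set V) ⊆ S ∧ T.card ≤ obstructionBound (Fintype.card W) n ∧
        ¬ ListColorableOn G H L T := by
  classical
  induction n with
  | zero =>
    exact fun L S v hv _ hl =>
      absurd (hl [] (by simp) (by simp) (by simpa using hv)) (by simp)
  | succ n ih =>
    intro L S v hv hconn hl hcol
    let L' : W → V → Set W := fun a x => {b | b ∈ L x ∧ (G.Adj v x → H.Adj a b)}
    have hT : ∀ a, ∃ T : Finset V, (T : Set V) ⊆ S \ {v} ∧
        T.card ≤ obstructionBound (Fintype.card W) n ∧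
        (a ∈ L v → ¬ ListColorableOn G H (L' a) T) := by
      intro a
      by_cases ha : a ∈ L v
      swap
      · exact ⟨∅, by simp, by simp, fun h => absurd h ha⟩
      have hcol' : ¬ ListColorableOn G H (L' a) (S \ {v}) := by
        rintro ⟨φ, h1, h2⟩
        have hu : ∀ x, x ≠ v → Function.update φ v a x = φ x := fun x hx =>
          Function.update_of_ne hx _ _
        have hself : Function.update φ v a v = a := Function.update_self _ _ _
        refine hcol ⟨Function.update φ v a, fun x hx => ?_, fun x hx y hy hxy => ?_⟩
        · by_cases hxv : x = v
          · rw [hxv, hself]; exact ha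
          · rw [hu x hxv]; exact (h1 x ⟨hx, hxv⟩).1
        · by_cases hxv : x = v
          · subst hxv
            rw [hself, hu y hxy.ne']
            exact (h1 y ⟨hy, hxy.ne'⟩).2 hxy
          · rw [hu x hxv]
            by_cases hyv : y = v
            · subst hyv
              rw [hself]
              exact ((h1 x ⟨hx, hxv⟩).2 hxy.symm).symm
            · rw [hu y hyv]
              exact h2 x ⟨hx, hxv⟩ y ⟨hy, hyv⟩ hxy
      obtain ⟨z, hz, hzcol⟩ := exists_component_not_listColorableOn hcol'
      obtain ⟨x, hx, hvx, hxz⟩ := (hconn z hz.1).exists_adj hz.2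
      have hsub : {y | ReachIn G (S \ {v}) x y} ⊆ S \ {v} := fun y hy => ReachIn.mem hy hx
      have hcomp : {y | ReachIn G (S \ {v}) z y} = {y | ReachIn G (S \ {v}) x y} :=
        Set.ext fun y => ⟨fun h => hxz.trans h, fun h => hxz.symm.trans h⟩
      rw [hcomp] at hzcol
      obtain ⟨T, hTS, hTc, hT⟩ := ih (L' a) _ x Relation.ReflTransGen.refl
        (fun y hy => ReachIn.in_component hy) (fun l hnd hch hlS => by
          have hvl : v ∉ x :: l := fun h => (hsub (hlS v h)).2 rfl
          have := hl (x :: l) (List.nodup_cons.2 ⟨hvl, hnd⟩)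
            (List.isChain_cons_cons.2 ⟨hvx, hch⟩)
            (List.forall_mem_cons.2 ⟨hv, fun y hy => (hsub (hlS y hy)).1⟩)
          simpa using this) hzcol
      exact ⟨T, hTS.trans hsub, hTc, fun _ => hT⟩
    choose T hTS hTc hT using hT
    refine ⟨insert v (Finset.univ.biUnion T), ?_, ?_, ?_⟩
    · intro x hx
      simp only [Finset.coe_insert, Finset.coe_biUnion, Finset.coe_univ, Set.mem_univ,
        Set.iUnion_true, Set.mem_insert_iff, Set.mem_iUnion] at hx
      rcases hx with rfl | ⟨a, ha⟩
      · exact hv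
      · exact (hTS a ha).1
    · calc (insert v (Finset.univ.biUnion T)).card
          ≤ (Finset.univ.biUnion T).card + 1 := Finset.card_insert_le _ _
        _ ≤ Fintype.card W * obstructionBound (Fintype.card W) n + 1 := by
            gcongr
            exact Finset.card_biUnion_le_card_mul _ _ _ fun a _ => hTc a
        _ = _ := by rw [obstructionBound, add_comm]
    · rintro ⟨φ, h1, h2⟩
      have hmem : ∀ x ∈ T (φ v), x ∈ ((insert v (Finset.univ.biUnion T) : Finset V) : Set V) :=
        fun x hx => Finset.mem_insert_of_mem
          (Finset.mem_biUnion.2 ⟨φ v, Finset.mem_univ _, hx⟩)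
      have hvmem : v ∈ ((insert v (Finset.univ.biUnion T) : Finset V) : Set V) :=
        Finset.mem_insert_self _ _
      exact hT (φ v) (h1 v hvmem) ⟨φ, fun x hx => ⟨h1 x (hmem x hx), h2 v hvmem x (hmem x hx)⟩,
        fun x hx y hy => h2 x (hmem x hx) y (hmem y hy)⟩

end Coloring

/-- There is a bound, depending only on `H`, `k` and `t`, such that every `(P_k, K_{t,t})`-free
graph with lists that is not `H`-list-colorable has an uncolorable induced subgraph within the bound. -/
theorem exists_small_obstruction {W : Type w} [Finite W] (H : SimpleGraph W) (k t : ℕ) :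
    ∃ B : ℕ, ∀ (V : Type u) (G : SimpleGraph V) (L : V → Set W),
      ¬ (pathGraph k).IsIndContained G →
      ¬ (completeBipartiteGraph (Fin t) (Fin t)).IsIndContained G →
      (¬ ∃ φ : G →g H, ∀ x, φ x ∈ L x) →
      ∃ T : Finset V, T.card ≤ B ∧ ¬ ∃ φ : G.induce (T : Set V) →g H, ∀ x : (T : Set V), φ x ∈ L x := by
  classical
  have := Fintype.ofFinite W
  rcases isEmpty_or_nonempty W with hW | hW
  · refine ⟨1, fun V G L _ _ hcol => ?_⟩
    rcases isEmpty_or_nonempty V with hV | ⟨⟨x⟩⟩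
    · exact absurd ⟨⟨isEmptyElim, fun {a} => isEmptyElim a⟩, isEmptyElim⟩ hcol
    · exact ⟨{x}, by simp, fun ⟨φ, _⟩ => isEmptyElim (φ ⟨x, by simp⟩)⟩
  obtain ⟨n, hn⟩ := exists_path_length_lt.{u} k t (Fintype.card W + 1)
  refine ⟨Fintype.card W + 1 + obstructionBound (Fintype.card W) n, fun V G L hP hB hcol => ?_⟩
  by_cases hK : (⊤ : SimpleGraph (Fin (Fintype.card W + 1))).IsIndContained G
  · -- As `H` is loopless, a clique with more vertices than `H` is an obstruction by itself.
    obtain ⟨e⟩ := hK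
    refine ⟨Finset.univ.map e.toEmbedding, by simp, fun ⟨φ, _⟩ => ?_⟩
    have hmem : ∀ i, e i ∈ ((Finset.univ.map e.toEmbedding : Finset V) : Set V) := fun i => by simp
    have hinj : Function.Injective fun i => φ ⟨e i, hmem i⟩ := fun i j hij => by
      by_contra hne
      have hadj : (G.induce ((Finset.univ.map e.toEmbedding : Finset V) : Set V)).Adj
          ⟨e i, hmem i⟩ ⟨e j, hmem j⟩ := e.map_adj_iff.2 hne
      exact (φ.map_adj hadj).ne hij
    have := Fintype.card_le_of_injective _ hinj
    simp at this
  · have hcol' : ¬ ListColorableOn G H L Set.univ := fun ⟨φ, h1, h2⟩ =>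
      hcol ⟨⟨φ, fun h => h2 _ trivial _ trivial h⟩, fun x => h1 x trivial⟩
    obtain ⟨x, -, hx⟩ := exists_component_not_listColorableOn hcol'
    obtain ⟨T, -, hTc, hT⟩ := exists_finset_of_paths_short n L _ x Relation.ReflTransGen.refl
      (fun y hy => ReachIn.in_component hy)
      (fun l hnd hch _ => (Nat.lt_succ_self _).trans (hn V G hP hB hK (x :: l) hnd hch)) hx
    refine ⟨T, hTc.trans (Nat.le_add_left _ _), fun ⟨φ, hφ⟩ => hT ?_⟩
    refine ⟨fun v => if h : v ∈ (T : Set V) then φ ⟨v, h⟩ else Classical.arbitrary W,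
      fun v hv => ?_, fun v hv y hy hvy => ?_⟩
    · simp only [dif_pos hv]
      exact hφ ⟨v, hv⟩
    · simp only [dif_pos hv, dif_pos hy]
      exact φ.map_adj hvy

/-! ### Minimal obstructions -/

/-- Labeled graphs of bounded size with finitely many labels are determined up to isomorphism by a
graph and a labeling on some `Fin n`, for which there are finitely many choices. -/
theorem finitelyManyUpTo_of_card_le {Q : Type v} [Finite Q] {P : LabeledGraph.{u} Q → Prop} {B : ℕ}
    (hB : ∀ X, P X → Nat.card X.V ≤ B) : FinitelyManyUpTo LabeledGraph.Isomorphic P := by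
  classical
  let C : Type v := Σ n : Fin (B + 1), SimpleGraph (Fin n) × (Fin n → Q)
  let R : LabeledGraph.{u} Q → C → Prop := fun X c => ∃ e : X.V ≃ Fin c.1,
    (∀ x y, X.graph.Adj x y ↔ c.2.1.Adj (e x) (e y)) ∧ ∀ x, X.label x = c.2.2 (e x)
  have hR : ∀ X, P X → ∃ c, R X c := fun X hX => by
    have := X.finite
    let e : X.V ≃ Fin (Nat.card X.V) := Finite.equivFin X.V
    exact ⟨⟨⟨Nat.card X.V, Nat.lt_succ_of_le (hB X hX)⟩, X.graph.map e.toEmbedding,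
      fun i => X.label (e.symm i)⟩, e, fun x y => (map_adj_apply (f := e.toEmbedding)).symm,
      fun x => by simp⟩
  have hiso : ∀ X Y c, R X c → R Y c → LabeledGraph.Isomorphic X Y := by
    rintro X Y c ⟨e, he, hel⟩ ⟨e', he', hel'⟩
    refine ⟨⟨e.trans e'.symm, fun {x y} => ?_⟩, fun x => ?_⟩
    · rw [he', he]
      simp
    · change Y.label (e'.symm (e x)) = _
      rw [hel', hel]
      simp
  let D : Set C := {c | ∃ X, P X ∧ R X c}
  choose f hfP hfR using fun c : D => c.2
  refine ⟨Set.range f, Set.finite_range f, ?_, fun X hX => ?_⟩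
  · rintro _ ⟨c, rfl⟩
    exact hfP c
  · obtain ⟨c, hc⟩ := hR X hX
    exact ⟨_, ⟨⟨c, X, hX, hc⟩, rfl⟩, hiso _ _ c hc (hfR _)⟩

/-- The subgraph induced by a set of vertices, with the labels it inherits. -/
def inducedOn {Q : Type v} (X : LabeledGraph.{u} Q) (T : Set X.V) : LabeledGraph.{u} Q where
  V := T
  finite := have := X.finite; inferInstance
  graph := X.graph.induce T
  label x := X.label x

theorem inducedOn_inducedLE {Q : Type v} [Preorder Q] (X : LabeledGraph.{u} Q) (T : Set X.V) :
    (inducedOn X T).InducedLE X :=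
  ⟨Embedding.induce T, fun _ => le_rfl⟩

theorem inducedOn_isPathBicliqueFree {Q : Type v} {X : LabeledGraph.{u} Q} {k t : ℕ}
    (hX : X.toFinGraph.IsPathBicliqueFree k t) (T : Set X.V) :
    (inducedOn X T).toFinGraph.IsPathBicliqueFree k t :=
  ⟨fun h => hX.1 (h.trans ⟨Embedding.induce T⟩), fun h => hX.2 (h.trans ⟨Embedding.induce T⟩)⟩

/-- A minimal obstruction is not larger than the small obstruction it contains. This applies to
every relation between the induced subgraph order and the comparison of sizes. -/
theorem finitelyManyUpTo_minimal {W : Type w} [Finite W] (H : SimpleGraph W) (k t : ℕ)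
    (Q : Set (Set W))
    (r : LabeledGraph.{u} (ReverseLists Q) → LabeledGraph.{u} (ReverseLists Q) → Prop)
    (hr : ∀ X Y, X.InducedLE Y → r X Y) (hcard : ∀ X Y, r X Y → Nat.card X.V ≤ Nat.card Y.V) :
    FinitelyManyUpTo LabeledGraph.Isomorphic (IsMinimalFor r
      (fun X : LabeledGraph.{u} (ReverseLists Q) =>
        X.toFinGraph.IsPathBicliqueFree k t ∧ ¬ X.IsListColorable H)) := by
  obtain ⟨B, hB⟩ := exists_small_obstruction.{u} H k t
  have : Finite (ReverseLists Q) := inferInstanceAs (Finite Q)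
  refine finitelyManyUpTo_of_card_le (B := B) fun X hX => ?_
  obtain ⟨⟨hfree, hcol⟩, hmin⟩ := hX
  obtain ⟨T, hTc, hT⟩ := hB X.V X.graph (fun x => (X.label x).list) hfree.1 hfree.2 hcol
  have hle : r X (inducedOn X T) := by
    by_contra hnot
    exact hmin ⟨inducedOn X T, ⟨inducedOn_isPathBicliqueFree hfree _, hT⟩,
      hr _ _ (inducedOn_inducedLE X _), hnot⟩
  refine (hcard _ _ hle).trans (le_trans (le_of_eq ?_) hTc)
  exact (Nat.card_coe_set_eq _).trans (Set.ncard_coe_finset T)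

/-- A critical graph coincides with the small subgraph that fails to be colorable. -/
theorem finitelyManyUpTo_critical (k t c : ℕ) :
    FinitelyManyUpTo FinGraph.Isomorphic
      (fun X : FinGraph.{u} => X.IsPathBicliqueFree k t ∧ X.IsCritical c) := by
  obtain ⟨B, hB⟩ := exists_small_obstruction.{u} (⊤ : SimpleGraph (Fin (c - 1))) k t
  obtain ⟨T, hTfin, hTP, hT⟩ := finitelyManyUpTo_of_card_le (Q := Unit) (B := B)
    (P := fun X : LabeledGraph.{u} Unit =>
      X.toFinGraph.IsPathBicliqueFree k t ∧ X.toFinGraph.IsCritical c) (by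
    rintro X ⟨hfree, hcol, hcrit⟩
    obtain ⟨T, hTc, hT⟩ := hB X.V X.graph (fun _ => Set.univ) hfree.1 hfree.2
      fun ⟨φ, _⟩ => hcol ⟨φ⟩
    have htop : (⊤ : X.graph.Subgraph).induce (T : Set X.V) = ⊤ := by
      by_contra hne
      obtain ⟨φ⟩ := hcrit _ hne
      refine hT ⟨⟨φ, fun {a b} h => φ.map_adj ?_⟩, fun _ => trivial⟩
      exact ⟨a.2, b.2, h⟩
    have huniv : (T : Set X.V) = Set.univ := congrArg Subgraph.verts htop
    rw [← Set.ncard_univ, ← huniv, Set.ncard_coe_finset]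
    exact hTc)
  refine ⟨LabeledGraph.toFinGraph '' T, hTfin.image _, ?_, fun X hX => ?_⟩
  · rintro _ ⟨Y, hY, rfl⟩
    exact hTP Y hY
  · obtain ⟨Y, hY, φ, -⟩ := hT ⟨X, fun _ => ()⟩ hX
    exact ⟨_, ⟨Y, hY, rfl⟩, ⟨φ⟩⟩

end PathBiclique

theorem theorem1 {W : Type w} [Finite W] (H : SimpleGraph W) (k t : ℕ) (hk : 0 < k) (ht : 0 < t) :
    (∀ Q : Set (Set W),
      FinitelyManyUpTo LabeledGraph.Isomorphic
        (IsMinimalFor LabeledGraph.InducedLE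
          (fun X : LabeledGraph.{u} (ReverseLists Q) =>
            X.toFinGraph.IsPathBicliqueFree k t ∧ ¬ X.IsListColorable H)) ∧
      FinitelyManyUpTo LabeledGraph.Isomorphic
        (IsMinimalFor LabeledGraph.SubgraphLE
          (fun X : LabeledGraph.{u} (ReverseLists Q) =>
            X.toFinGraph.IsPathBicliqueFree k t ∧ ¬ X.IsListColorable H))) ∧
    ∀ c : ℕ, 0 < c →
      FinitelyManyUpTo FinGraph.Isomorphic
        (fun X : FinGraph.{u} => X.IsPathBicliqueFree k t ∧ X.IsCritical c) := by
  refine ⟨fun Q => ⟨?_, ?_⟩, fun c _ => PathBiclique.finitelyManyUpTo_critical k t c⟩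
  · refine PathBiclique.finitelyManyUpTo_minimal H k t Q _ (fun _ _ h => h) fun X Y h => ?_
    obtain ⟨σ, -⟩ := h
    have := Y.finite
    exact Nat.card_le_card_of_injective σ σ.injective
  · refine PathBiclique.finitelyManyUpTo_minimal H k t Q _ (fun X Y h => ?_) fun X Y h => ?_
    · obtain ⟨σ, hσ⟩ := h
      exact ⟨σ.toCopy, hσ⟩
    · obtain ⟨σ, -⟩ := h
      have := Y.finite
      exact Nat.card_le_card_of_injective σ σ.injective
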